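/- Let $n \ge 2$ and $N = n^2$, and consider the $\sqrt N \times \sqrt N$ grid with periodic boundary conditions, with vertices $(x,y) \in (\mathbb Z/n\mathbb Z)^2$. The quantum walk acts on $\mathcal H = \mathbb C^4 \otimes \mathbb C^N$ with orthonormal basis $|i\rangle\otimes|x,y\rangle$, where $i \in \{\rightarrow,\leftarrow,\uparrow,\downarrow\}$ is the coin register. Let $|s\rangle = \frac12\sum_i |i\rangle$, let $C_0 = 2|s\rangle\langle s| - I$ be the Grover coin, and let $S_{ff}$ be the flip-flop shift $$|\rightarrow\rangle|x,y\rangle \mapsto |\leftarrow\rangle|x+1,y\rangle,\quad |\leftarrow\rangle|x,y\rangle \mapsto |\rightarrow\rangle|x-1,y\rangle,\quad |\uparrow\rangle|x,y\rangle \mapsto |\downarrow\rangle|x,y+1\rangle,\quad |\downarrow\rangle|x,y\rangle \mapsto |\uparrow\rangle|x,y-1\rangle .$$ For a marked vertex $v$ put $$U'_v = S_{ff}\,\bigl(C_0\otimes(I-|v\rangle\langle v|) + (-I)\otimes|v\rangle\langle v|\bigr),\qquad |\Phi_0\rangle = \frac{1}{\sqrt{4N}}\sum_{i}\sum_{x,y}|i\rangle\otimes|x,y\rangle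 .$$ Then there is a number of steps $T = T(N) = O(\sqrt{N\log N})$, not depending on $v$, such that for every marked vertex $v$ the probability $$p_T = \sum_i \bigl|\bigl(\langle i|\otimes\langle v|\bigr)\,(U'_v)^T|\Phi_0\rangle\bigr|^2$$ of finding $v$ when the position register is measured after $T$ steps satisfies $p_T = \Omega(1/\log N)$. That is, there are absolute constants $K, c > 0$ such that for all $n \ge 2$ one can choose $T \le K\sqrt{N\log N}$ with $p_T \ge c/\log N$ for all $v$. -/

import Mathlib

open scoped Matrix Kronecker

noncomputable section

namespace GridWalk

/-- The four edge labels `→, ←, ↑, ↓` at a vertex of the grid: the basis of the coin space. -/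
inductive Dir
  | right
  | left
  | up
  | down
  deriving DecidableEq

instance : Fintype Dir where
  elems := {.right, .left, .up, .down}
  complete := by intro i; cases i <;> simp

/-- The vertices of the `n × n` grid with periodic boundary conditions (so `N = n ^ 2`). -/
abbrev Vertex (n : ℕ) : Type := ZMod n × ZMod n

/-- The computational basis `|i⟩ ⊗ |x, y⟩` of the space of coin and vertices. -/
abbrev Basis (n : ℕ) : Type := Dir × Vertex n

/-- The coin permutation `π` of the flip-flop shift: exchange `→` with `←` and `↑` with `↓`. -/
def Dir.flip : Dir → Dir
  | .right => .left
  | .left => .right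
  | .up => .down
  | .down => .up

/-- The displacement along the edge with a given label. -/
def Dir.step (n : ℕ) : Dir → Vertex n
  | .right => (1, 0)
  | .left => (-1, 0)
  | .up => (0, 1)
  | .down => (0, -1)

/-- The uniform coin state `|s⟩ = (1 / √4) ∑ i, |i⟩`. -/
def coinState : Dir → ℂ := fun _ => 1 / ((√4 : ℝ) : ℂ)

/-- The Grover coin `C₀ = 2 |s⟩⟨s| - I`. -/
def groverCoin : Matrix Dir Dir ℂ :=
  (2 : ℂ) • Matrix.vecMulVec coinState (star coinState) - 1

/-- The marking coin `C₁ = -I`. -/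
def markingCoin : Matrix Dir Dir ℂ := -1

/-- The flip-flop shift `S_ff : |i⟩ ⊗ |x⟩ ↦ |π i⟩ ⊗ |x + step i⟩`. -/
def flipFlopShift (n : ℕ) : Matrix (Basis n) (Basis n) ℂ :=
  Matrix.of fun b a => if b = (a.1.flip, a.2 + a.1.step n) then 1 else 0

/-- The projection `|v⟩⟨v|` on the vertex space. -/
def vertexProj (n : ℕ) (v : Vertex n) : Matrix (Vertex n) (Vertex n) ℂ :=
  Matrix.single v v 1

/-- The perturbed coin `C' = C₀ ⊗ (I - |v⟩⟨v|) + C₁ ⊗ |v⟩⟨v|`. -/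
def markedCoin (n : ℕ) (v : Vertex n) : Matrix (Basis n) (Basis n) ℂ :=
  groverCoin ⊗ₖ (1 - vertexProj n v) + markingCoin ⊗ₖ vertexProj n v

/-- One step `U' = S_ff C'` of the walk with marked vertex `v`. -/
def markedWalk (n : ℕ) [NeZero n] (v : Vertex n) : Matrix (Basis n) (Basis n) ℂ :=
  flipFlopShift n * markedCoin n v

/-- The uniform superposition `|Φ₀⟩ = (1 / √(4 N)) ∑ i x, |i⟩ ⊗ |x⟩`, with `N = n ^ 2`. -/
def uniformState (n : ℕ) : Basis n → ℂ := fun _ => 1 / ((√(4 * (n : ℝ) ^ 2) : ℝ) : ℂ)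

/-- The state `U' ^ T |Φ₀⟩` of the search algorithm after `T` steps. -/
def stateAfter (n : ℕ) [NeZero n] (v : Vertex n) (T : ℕ) : Basis n → ℂ :=
  (markedWalk n v ^ T) *ᵥ uniformState n

/-- The probability that measuring the position register after `T` steps yields the marked
vertex `v`. -/
def successProb (n : ℕ) [NeZero n] (v : Vertex n) (T : ℕ) : ℝ :=
  ∑ i : Dir, ‖stateAfter n v T (i, v)‖ ^ 2

end GridWalk

end

/-!
Write `U` for one step of the walk, `s` for the uniform coin state at the marked vertex and `Φ` for
the uniform superposition, so that `⟪s, Φ⟫ = 1 / n`. Flipping the sign of the component of `Φ`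
along `s` undoes the marking: `U (Φ - 2⟪s, Φ⟫ s) = Φ`. Hence the Abel sum `y = ∑ z ^ t U⁻ᵗ s` of
the backward orbit of `s` satisfies `‖⟪y, Φ⟫‖ ≥ ‖⟪s, Φ⟫‖ ‖y‖²`, while `⟪y, Φ⟫` is essentially a
sum of the overlaps `⟪s, Uᵗ Φ⟫` over the first `O(1 / (1 - z))` times. A lower bound for `‖y‖`
therefore yields a time with a large overlap.

To bound `‖y‖` below, pair `y` with a flow on the edges of the torus from the marked vertex to the
uniform distribution. An antisymmetric flow is changed by `U` only through its divergence, so this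
one is nearly fixed, with error `1 / n`; its overlap with `s` is about `1 / 2`, and, as in the
resistance of a square grid, its energy can be made `O(log n)`. With `1 - z = 1 / √(N log N)` this
gives `‖y‖ = Ω(n)`, hence an overlap `Ω(1 / √log N)` within `O(√(N log N))` steps.
-/

noncomputable section

namespace UnitarySearch

open scoped InnerProductSpace

variable {𝕜 E : Type*} [RCLike 𝕜] [NormedAddCommGroup E] [InnerProductSpace 𝕜 E]

/-- The Abel sum `∑ z ^ t U⁻ᵗ s` of the backward orbit of `s` under the unitary `U`. Pairing it
with `Φ` averages the overlaps `⟪s, Uᵗ Φ⟫` over times `t` up to about `1 / (1 - z)`. -/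
def abelSum (U : E ≃ₗᵢ[𝕜] E) (s : E) (z : ℝ) : E :=
  ∑' t : ℕ, (z : 𝕜) ^ t • (U ^ t)⁻¹ s

variable [CompleteSpace E] (U : E ≃ₗᵢ[𝕜] E) {s Φ : E} {z : ℝ}

theorem summable_abelSum (s : E) (hz : |z| < 1) :
    Summable fun t : ℕ => (z : 𝕜) ^ t • (U ^ t)⁻¹ s := by
  refine .of_norm ?_
  simp only [norm_smul, norm_pow, RCLike.norm_ofReal, LinearIsometryEquiv.norm_map]
  exact (summable_geometric_of_lt_one (abs_nonneg z) hz).mul_right ‖s‖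

theorem map_abelSum (s : E) (hz : |z| < 1) :
    U (abelSum U s z) = (z : 𝕜) • abelSum U s z + U s := by
  have shift (t : ℕ) : U ((z : 𝕜) ^ (t + 1) • (U ^ (t + 1))⁻¹ s)
      = (z : 𝕜) • (z : 𝕜) ^ t • (U ^ t)⁻¹ s := by
    rw [map_smul, ← Function.comp_apply (f := U), ← LinearIsometryEquiv.coe_mul, pow_succ U,
      mul_inv_rev, mul_inv_cancel_left, pow_succ', mul_smul]
  have hsum : Summable fun t : ℕ => U ((z : 𝕜) ^ t • (U ^ t)⁻¹ s) :=
    U.toContinuousLinearEquiv.summable.2 (summable_abelSum U s hz)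
  calc U (abelSum U s z)
      = ∑' t : ℕ, U ((z : 𝕜) ^ t • (U ^ t)⁻¹ s) := U.toContinuousLinearEquiv.map_tsum
    _ = U s + ∑' t : ℕ, (z : 𝕜) • (z : 𝕜) ^ t • (U ^ t)⁻¹ s := by
      rw [hsum.tsum_eq_zero_add]
      simp only [shift, pow_zero, inv_one, one_smul, LinearIsometryEquiv.coe_one, id]
    _ = (z : 𝕜) • abelSum U s z + U s := by rw [tsum_const_smul'', add_comm, abelSum]

theorem inner_abelSum (s : E) (hz : |z| < 1) (x : E) :
    ⟪abelSum U s z, x⟫_𝕜 = ⟪s, x⟫_𝕜 + z * ⟪abelSum U s z, U x⟫_𝕜 := by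
  rw [← U.inner_map_map (abelSum U s z) x, map_abelSum U s hz, inner_add_left, inner_smul_left,
    U.inner_map_map, RCLike.conj_ofReal, add_comm]

theorem inner_abelSum_eq_sum_range (s : E) (hz : |z| < 1) (x : E) (T : ℕ) :
    ⟪abelSum U s z, x⟫_𝕜 = ∑ t ∈ Finset.range T, (z : 𝕜) ^ t * ⟪s, (U ^ t) x⟫_𝕜
      + (z : 𝕜) ^ T * ⟪abelSum U s z, (U ^ T) x⟫_𝕜 := by
  induction T with
  | zero => simp
  | succ T ih =>
    rw [ih, Finset.sum_range_succ, inner_abelSum U s hz ((U ^ T) x), pow_succ' U,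
      LinearIsometryEquiv.coe_mul, Function.comp_apply]
    ring

theorem norm_inner_abelSum_le (s : E) (hz₀ : 0 ≤ z) (hz₁ : z < 1) (x : E) {δ : ℝ} {T : ℕ}
    (hδ : 0 ≤ δ) (h : ∀ t < T, ‖⟪s, (U ^ t) x⟫_𝕜‖ ≤ δ) :
    ‖⟪abelSum U s z, x⟫_𝕜‖ ≤ δ / (1 - z) + z ^ T * (‖abelSum U s z‖ * ‖x‖) := by
  have norm_pow_mul (t : ℕ) (c : 𝕜) : ‖(z : 𝕜) ^ t * c‖ = z ^ t * ‖c‖ := by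
    rw [norm_mul, norm_pow, RCLike.norm_of_nonneg hz₀]
  rw [inner_abelSum_eq_sum_range U s (abs_lt.2 ⟨by linarith, hz₁⟩) x T]
  refine (norm_add_le _ _).trans (add_le_add ?_ ?_)
  · calc ‖∑ t ∈ Finset.range T, (z : 𝕜) ^ t * ⟪s, (U ^ t) x⟫_𝕜‖
        ≤ ∑ t ∈ Finset.range T, z ^ t * δ := by
          refine norm_sum_le_of_le _ fun t ht => ?_
          rw [norm_pow_mul]
          gcongr
          exact h t (Finset.mem_range.1 ht)
      _ = (1 - z ^ T) / (1 - z) * δ := by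
          rw [← Finset.sum_mul, geom_sum_eq hz₁.ne, ← neg_div_neg_eq, neg_sub, neg_sub]
      _ ≤ 1 / (1 - z) * δ := by
          have := pow_nonneg hz₀ T
          have := sub_pos.2 hz₁
          gcongr
          linarith
      _ = δ / (1 - z) := by ring
  · rw [norm_pow_mul, ← LinearIsometryEquiv.norm_map (U ^ T) x]
    gcongr
    exact norm_inner_le_norm _ _

theorem norm_inner_le_norm_abelSum_mul (s : E) (hz : |z| < 1) (p : E) :
    ‖⟪s, p⟫_𝕜‖ ≤ ‖abelSum U s z‖ * ((1 - z) * ‖p‖ + ‖p - U p‖) := by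
  have hp : ⟪s, p⟫_𝕜 = ⟪abelSum U s z, ((1 - z : ℝ) : 𝕜) • U p + (p - U p)⟫_𝕜 := by
    rw [inner_add_right, inner_smul_right, inner_sub_right, inner_abelSum U s hz p]
    push_cast
    ring
  rw [hp]
  refine (norm_inner_le_norm _ _).trans ?_
  gcongr
  refine (norm_add_le _ _).trans_eq ?_
  rw [norm_smul, U.norm_map, RCLike.norm_of_nonneg (by linarith [(abs_lt.1 hz).2])]

theorem norm_abelSum_sub (s : E) (hz : |z| < 1) :
    ‖abelSum U s z - s‖ = |z| * ‖abelSum U s z‖ := by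
  rw [← U.norm_map, map_sub, map_abelSum U s hz, add_sub_cancel_right, norm_smul,
    RCLike.norm_ofReal]

theorem one_sub_sq_mul_norm_abelSum_sq (s : E) (hz : |z| < 1) :
    (1 - z ^ 2) * ‖abelSum U s z‖ ^ 2 = 2 * RCLike.re ⟪abelSum U s z, s⟫_𝕜 - ‖s‖ ^ 2 := by
  have h := congrArg (· ^ 2) (norm_abelSum_sub U s hz)
  simp only [mul_pow, sq_abs, norm_sub_sq (𝕜 := 𝕜)] at h
  linarith

variable {U}

theorem one_sub_mul_inner_abelSum (hz : |z| < 1) (hs : ‖s‖ = 1)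
    (hΦ : U (Φ - (2 * ⟪s, Φ⟫_𝕜) • s) = Φ) :
    (1 - z) * ⟪abelSum U s z, Φ⟫_𝕜 = ⟪s, Φ⟫_𝕜 * (2 * ⟪abelSum U s z, s⟫_𝕜 - 1) := by
  have h := inner_abelSum U s hz (Φ - (2 * ⟪s, Φ⟫_𝕜) • s)
  simp only [hΦ, inner_sub_right, inner_smul_right, inner_self_eq_norm_sq_to_K, hs] at h
  push_cast at h
  linear_combination h

theorem norm_inner_mul_norm_abelSum_sq_le (hz₀ : 0 ≤ z) (hz₁ : z < 1) (hs : ‖s‖ = 1)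
    (hΦ : U (Φ - (2 * ⟪s, Φ⟫_𝕜) • s) = Φ) :
    ‖⟪s, Φ⟫_𝕜‖ * ‖abelSum U s z‖ ^ 2 ≤ ‖⟪abelSum U s z, Φ⟫_𝕜‖ := by
  have hz : |z| < 1 := abs_lt.2 ⟨by linarith, hz₁⟩
  have hpos : 0 < 1 - z := sub_pos.2 hz₁
  have hre : (1 - z ^ 2) * ‖abelSum U s z‖ ^ 2 ≤ ‖2 * ⟪abelSum U s z, s⟫_𝕜 - 1‖ := by
    refine le_trans (le_of_eq ?_) (RCLike.re_le_norm _)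
    rw [one_sub_sq_mul_norm_abelSum_sq U s hz, hs]
    simp
  refine le_of_mul_le_mul_left ?_ hpos
  calc (1 - z) * (‖⟪s, Φ⟫_𝕜‖ * ‖abelSum U s z‖ ^ 2)
      ≤ ‖⟪s, Φ⟫_𝕜‖ * ((1 - z ^ 2) * ‖abelSum U s z‖ ^ 2) := by
        rw [mul_left_comm]
        gcongr
        nlinarith
    _ ≤ ‖⟪s, Φ⟫_𝕜‖ * ‖2 * ⟪abelSum U s z, s⟫_𝕜 - 1‖ := by gcongr
    _ = (1 - z) * ‖⟪abelSum U s z, Φ⟫_𝕜‖ := by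
      rw [← norm_mul, ← one_sub_mul_inner_abelSum hz hs hΦ, norm_mul, ← RCLike.ofReal_one,
        ← RCLike.ofReal_sub, RCLike.norm_of_nonneg hpos.le]

theorem exists_le_norm_inner_pow (hz₀ : 0 ≤ z) (hz₁ : z < 1) (hs : ‖s‖ = 1) (hΦ₁ : ‖Φ‖ = 1)
    (hΦ : U (Φ - (2 * ⟪s, Φ⟫_𝕜) • s) = Φ) (hsΦ : ⟪s, Φ⟫_𝕜 ≠ 0) {δ : ℝ} {T : ℕ} (hδ : 0 ≤ δ)
    (hT : δ / (1 - z) + z ^ T / ‖⟪s, Φ⟫_𝕜‖ < ‖⟪s, Φ⟫_𝕜‖ * ‖abelSum U s z‖ ^ 2) :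
    ∃ t < T, δ ≤ ‖⟪s, (U ^ t) Φ⟫_𝕜‖ := by
  have hr : 0 < ‖⟪s, Φ⟫_𝕜‖ := norm_pos_iff.2 hsΦ
  have hlow := norm_inner_mul_norm_abelSum_sq_le hz₀ hz₁ hs hΦ
  have hnorm : ‖abelSum U s z‖ ≤ 1 / ‖⟪s, Φ⟫_𝕜‖ := by
    have hCS := norm_inner_le_norm (𝕜 := 𝕜) (abelSum U s z) Φ
    rw [hΦ₁, mul_one] at hCS
    rw [le_div_iff₀' hr]
    by_contra! h
    nlinarith [norm_nonneg (abelSum U s z)]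
  by_contra! hsmall
  refine hT.not_ge (hlow.trans ?_)
  refine (norm_inner_abelSum_le U s hz₀ hz₁ Φ hδ fun t ht => (hsmall t ht).le).trans ?_
  rw [hΦ₁, mul_one, div_eq_mul_one_div (z ^ T)]
  gcongr

end UnitarySearch

namespace GridWalk

open scoped InnerProductSpace
open UnitarySearch

theorem sum_norm_sq_grover_diffusion {ι F : Type*} [Fintype ι] [NormedAddCommGroup F]
    [InnerProductSpace ℝ F] (f : ι → F) :
    ∑ i, ‖(2 / Fintype.card ι : ℝ) • ∑ j, f j - f i‖ ^ 2 = ∑ i, ‖f i‖ ^ 2 := by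
  rcases isEmpty_or_nonempty ι with _ | _
  · simp
  have hcard : (Fintype.card ι : ℝ) ≠ 0 := Nat.cast_ne_zero.2 Fintype.card_ne_zero
  simp only [norm_sub_sq_real, Finset.sum_add_distrib, Finset.sum_sub_distrib, ← Finset.mul_sum,
    ← inner_sum, real_inner_smul_left, real_inner_self_eq_norm_sq, norm_smul, mul_pow,
    Real.norm_eq_abs, sq_abs, Finset.sum_const, Finset.card_univ, nsmul_eq_mul]
  field_simp
  ring

theorem Dir.sum_univ {M : Type*} [AddCommMonoid M] (f : Dir → M) :
    ∑ i, f i = f .right + (f .left + (f .up + f .down)) := by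
  change ∑ i ∈ ({.right, .left, .up, .down} : Finset Dir), f i = _
  simp

theorem Dir.card : Fintype.card Dir = 4 := rfl

theorem Dir.flip_flip (i : Dir) : i.flip.flip = i := by cases i <;> rfl

theorem Dir.step_flip (n : ℕ) (i : Dir) : i.flip.step n = -i.step n := by
  cases i <;> simp [Dir.flip, Dir.step]

theorem groverCoin_apply (i j : Dir) : groverCoin i j = 1 / 2 - (1 : Matrix Dir Dir ℂ) i j := by
  have h : √(4 : ℝ) = 2 := by
    rw [show (4 : ℝ) = 2 ^ 2 by norm_num, Real.sqrt_sq zero_le_two]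
  simp [groverCoin, Matrix.vecMulVec_apply, coinState, h]

theorem groverCoin_mulVec (f : Dir → ℂ) (i : Dir) :
    (groverCoin *ᵥ f) i = 1 / 2 * ∑ j, f j - f i := by
  simp [Matrix.mulVec, dotProduct, groverCoin_apply, sub_mul, Finset.mul_sum, Matrix.one_apply]

theorem sum_norm_sq_groverCoin_mulVec (f : Dir → ℂ) :
    ∑ i, ‖(groverCoin *ᵥ f) i‖ ^ 2 = ∑ i, ‖f i‖ ^ 2 := by
  rw [← sum_norm_sq_grover_diffusion f]
  simp only [groverCoin_mulVec, Dir.card, Complex.real_smul]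
  norm_num

theorem uniformState_apply {n : ℕ} (b : Basis n) : uniformState n b = 1 / (2 * n) := by
  have h : √(4 * (n : ℝ) ^ 2) = 2 * n := by
    rw [show (4 * (n : ℝ) ^ 2) = (2 * n) ^ 2 by ring, Real.sqrt_sq (by positivity)]
  simp [uniformState, h]

/-- The state `|s⟩ ⊗ |v⟩`: the coin is uniform and the walker is at `v`. -/
def markedState {n : ℕ} (v : Vertex n) : EuclideanSpace ℂ (Basis n) :=
  WithLp.toLp 2 fun b => if b.2 = v then 1 / 2 else 0

theorem markedState_apply {n : ℕ} (v : Vertex n) (b : Basis n) :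
    markedState v b = if b.2 = v then 1 / 2 else 0 := rfl

/-- The flip-flop shift as an involution of the basis: every edge is traversed and then traversed
back. -/
def edgeSwap (n : ℕ) : Equiv.Perm (Basis n) :=
  Function.Involutive.toPerm (fun b => (b.1.flip, b.2 + b.1.step n)) fun b => by
    simp [Dir.flip_flip, Dir.step_flip]

section Walk

variable {n : ℕ} [NeZero n]

theorem card_basis : (Fintype.card (Basis n) : ℝ) = 4 * n ^ 2 := by
  simp [Dir.card, ZMod.card, sq]

theorem flipFlopShift_mulVec (ψ : Basis n → ℂ) (b : Basis n) :
    (flipFlopShift n *ᵥ ψ) b = ψ (edgeSwap n b) := by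
  have h (a : Basis n) : b = (a.1.flip, a.2 + a.1.step n) ↔ a = edgeSwap n b :=
    eq_comm.trans (edgeSwap n).symm_apply_eq
  simp [Matrix.mulVec, dotProduct, flipFlopShift, h]

theorem markedCoin_mulVec (v : Vertex n) (ψ : Basis n → ℂ) (i : Dir) (x : Vertex n) :
    (markedCoin n v *ᵥ ψ) (i, x) =
      if x = v then -ψ (i, x) else (groverCoin *ᵥ fun j => ψ (j, x)) i := by
  have coin_apply (j : Dir) (y : Vertex n) : markedCoin n v (i, x) (j, y) =
      if x = y then if x = v then -(1 : Matrix Dir Dir ℂ) i j else groverCoin i j else 0 := by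
    by_cases hxy : x = y <;> by_cases hxv : x = v <;>
      simp_all [markedCoin, markingCoin, vertexProj, Matrix.single_apply, eq_comm]
  rw [Matrix.mulVec, dotProduct, Fintype.sum_prod_type]
  simp only [coin_apply, ite_mul, zero_mul, Finset.sum_ite_eq, Finset.mem_univ, if_true]
  split_ifs
  · simp [Matrix.one_apply]
  · rfl

theorem markedWalk_mulVec (v : Vertex n) (ψ : Basis n → ℂ) (i : Dir) (x : Vertex n) :
    (markedWalk n v *ᵥ ψ) (i, x) =
      (if x + i.step n = v then 0 else 1 / 2 * ∑ j, ψ (j, x + i.step n))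
        - ψ (i.flip, x + i.step n) := by
  rw [markedWalk, ← Matrix.mulVec_mulVec, flipFlopShift_mulVec]
  refine (markedCoin_mulVec v ψ i.flip (x + i.step n)).trans ?_
  rw [groverCoin_mulVec]
  split_ifs <;> simp

theorem sum_norm_sq_markedWalk_mulVec (v : Vertex n) (ψ : Basis n → ℂ) :
    ∑ b, ‖(markedWalk n v *ᵥ ψ) b‖ ^ 2 = ∑ b, ‖ψ b‖ ^ 2 := by
  simp only [markedWalk, ← Matrix.mulVec_mulVec, flipFlopShift_mulVec]
  rw [Equiv.sum_comp (edgeSwap n) fun b => ‖(markedCoin n v *ᵥ ψ) b‖ ^ 2,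
    Fintype.sum_prod_type_right, Fintype.sum_prod_type_right (f := fun b => ‖ψ b‖ ^ 2)]
  refine Finset.sum_congr rfl fun x _ => ?_
  simp only [markedCoin_mulVec]
  split_ifs
  · simp
  · exact sum_norm_sq_groverCoin_mulVec fun j => ψ (j, x)

/-- One step of the walk as a unitary operator on the Hilbert space of coin and vertices. -/
def walkUnitary (v : Vertex n) : EuclideanSpace ℂ (Basis n) ≃ₗᵢ[ℂ] EuclideanSpace ℂ (Basis n) :=
  LinearIsometry.toLinearIsometryEquiv
    { toLinearMap := Matrix.toEuclideanLin (markedWalk n v)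
      norm_map' := fun ψ => by
        rw [EuclideanSpace.norm_eq, EuclideanSpace.norm_eq]
        exact congrArg _ (sum_norm_sq_markedWalk_mulVec v ψ) }
    rfl

theorem walkUnitary_toLp (v : Vertex n) (ψ : Basis n → ℂ) :
    walkUnitary v (WithLp.toLp 2 ψ) = WithLp.toLp 2 (markedWalk n v *ᵥ ψ) := rfl

theorem walkUnitary_apply (v : Vertex n) (ψ : EuclideanSpace ℂ (Basis n)) (i : Dir)
    (x : Vertex n) :
    walkUnitary v ψ (i, x) =
      (if x + i.step n = v then 0 else 1 / 2 * ∑ j, ψ (j, x + i.step n))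
        - ψ (i.flip, x + i.step n) :=
  markedWalk_mulVec v ψ i x

theorem stateAfter_succ (v : Vertex n) (t : ℕ) :
    stateAfter n v (t + 1) = markedWalk n v *ᵥ stateAfter n v t := by
  rw [stateAfter, stateAfter, Matrix.mulVec_mulVec, ← pow_succ']

theorem walkUnitary_pow_uniformState (v : Vertex n) (t : ℕ) :
    (walkUnitary v ^ t) (WithLp.toLp 2 (uniformState n)) = WithLp.toLp 2 (stateAfter n v t) := by
  induction t with
  | zero => simp [stateAfter]
  | succ t ih =>
    rw [pow_succ', LinearIsometryEquiv.coe_mul, Function.comp_apply, ih, walkUnitary_toLp,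
      stateAfter_succ]

theorem stateAfter_translate (v : Vertex n) (t : ℕ) (i : Dir) (x : Vertex n) :
    stateAfter n v t (i, x) = stateAfter n 0 t (i, x - v) := by
  induction t generalizing i x with
  | zero => simp [stateAfter, uniformState]
  | succ t ih =>
    simp only [stateAfter_succ, markedWalk_mulVec, ih, sub_add_eq_add_sub, sub_eq_zero]

theorem successProb_eq_successProb_zero (v : Vertex n) (t : ℕ) :
    successProb n v t = successProb n 0 t := by
  simp only [successProb, stateAfter_translate v, sub_self]

theorem inner_markedState (v : Vertex n) (ψ : EuclideanSpace ℂ (Basis n)) :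
    ⟪markedState v, ψ⟫_ℂ = 1 / 2 * ∑ i, ψ (i, v) := by
  simp [PiLp.inner_apply, Fintype.sum_prod_type, markedState_apply, Finset.mul_sum, apply_ite,
    Complex.conj_ofNat, mul_comm]

theorem norm_markedState (v : Vertex n) : ‖markedState v‖ = 1 := by
  have hsum : ∑ b, ‖markedState v b‖ ^ 2 = 1 := by
    simp only [markedState_apply, one_div, apply_ite, norm_inv, Complex.norm_ofNat, norm_zero,
      ite_pow, inv_pow, ne_eq, OfNat.ofNat_ne_zero, not_false_eq_true, zero_pow,
      Fintype.sum_prod_type, Finset.sum_ite_eq', Finset.mem_univ, ↓reduceIte, Finset.sum_const,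
      Finset.card_univ, Dir.card, nsmul_eq_mul, Nat.cast_ofNat]
    norm_num
  rw [EuclideanSpace.norm_eq, hsum, Real.sqrt_one]

theorem norm_uniformState : ‖WithLp.toLp 2 (uniformState n)‖ = 1 := by
  have hn : (n : ℝ) ≠ 0 := NeZero.ne _
  rw [EuclideanSpace.norm_eq, Real.sqrt_eq_one]
  simp only [uniformState_apply, Finset.sum_const, Finset.card_univ, nsmul_eq_mul, card_basis,
    one_div, mul_inv_rev, norm_mul, norm_inv, RCLike.norm_natCast, Complex.norm_ofNat]
  field_simp
  norm_num

theorem inner_markedState_uniformState (v : Vertex n) :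
    ⟪markedState v, WithLp.toLp 2 (uniformState n)⟫_ℂ = 1 / n := by
  have hn : (n : ℂ) ≠ 0 := NeZero.ne _
  simp only [inner_markedState, uniformState_apply, Dir.sum_univ]
  field_simp
  norm_num

theorem walkUnitary_reflect_uniformState (v : Vertex n) :
    walkUnitary v (WithLp.toLp 2 (uniformState n)
      - (2 * ⟪markedState v, WithLp.toLp 2 (uniformState n)⟫_ℂ) • markedState v)
      = WithLp.toLp 2 (uniformState n) := by
  have hn : (n : ℂ) ≠ 0 := NeZero.ne _
  ext ⟨i, x⟩
  rw [inner_markedState_uniformState]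
  simp only [walkUnitary_apply, PiLp.sub_apply, PiLp.smul_apply, uniformState_apply,
    markedState_apply, smul_eq_mul, Dir.sum_univ]
  split_ifs <;> field_simp <;> norm_num

theorem norm_inner_markedState_sq_le_successProb (v : Vertex n) (t : ℕ) :
    ‖⟪markedState v, WithLp.toLp 2 (stateAfter n v t)⟫_ℂ‖ ^ 2 ≤ successProb n v t := by
  have cauchy : ‖∑ i, stateAfter n v t (i, v)‖ ^ 2 ≤ 4 * ∑ i, ‖stateAfter n v t (i, v)‖ ^ 2 :=
    calc ‖∑ i, stateAfter n v t (i, v)‖ ^ 2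
        ≤ (∑ i, ‖stateAfter n v t (i, v)‖) ^ 2 := by gcongr; exact norm_sum_le _ _
      _ ≤ 4 * ∑ i, ‖stateAfter n v t (i, v)‖ ^ 2 := sq_sum_le_card_mul_sum_sq
  rw [inner_markedState, norm_mul, mul_pow, successProb]
  norm_num
  linarith

end Walk

/-- Flow entering `(a, b)` from the left in a flow on the square `[0, n)²` from the origin to the
uniform distribution. The flow first moves right and up so as to be uniform on each antidiagonal
`a + b = k`, up to `k = n - 1`; from that antidiagonal it spreads uniformly over each row. At the
origin the first quotient is `0 / 0 = 0`. -/
def inflowRight (n a b : ℕ) : ℝ :=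
  (if a + b < n then (a : ℝ) / ((a + b) * (a + b + 1)) else 1 / n) - a / n ^ 2

/-- Flow entering `(a, b)` from below in the flow of `inflowRight`. -/
def inflowUp (n a b : ℕ) : ℝ :=
  if a + b < n then (b : ℝ) / ((a + b) * (a + b + 1)) else 0

theorem inflowRight_period {n b : ℕ} (hb : b < n) : inflowRight n n b = inflowRight n 0 b := by
  have hn : (n : ℝ) ≠ 0 := by exact_mod_cast (Nat.zero_le b).trans_lt hb |>.ne'
  simp only [inflowRight, add_lt_iff_neg_left, not_lt_zero, ↓reduceIte, zero_add, hb,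
    Nat.cast_zero, zero_div, sub_self]
  field_simp
  simp

theorem inflowUp_period (n a : ℕ) : inflowUp n a n = inflowUp n a 0 := by
  simp [inflowUp]

theorem inflow_antidiagonal (a b : ℕ) :
    (a : ℝ) / ((a + b) * (a + b + 1)) + b / ((a + b) * (a + b + 1))
      = if a = 0 ∧ b = 0 then 0 else 1 / (a + b + 1 : ℝ) := by
  split_ifs with h
  · simp [h]
  · have : (a + b : ℝ) ≠ 0 := by
      have : a + b ≠ 0 := by omega
      exact_mod_cast this
    field_simp

theorem outflow_antidiagonal (a b : ℕ) :
    ((a + 1 : ℕ) : ℝ) / (((a + 1 : ℕ) + b) * ((a + 1 : ℕ) + b + 1))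
      + ((b + 1 : ℕ) : ℝ) / ((a + (b + 1 : ℕ)) * (a + (b + 1 : ℕ) + 1)) = 1 / (a + b + 1 : ℝ) := by
  push_cast
  field_simp
  ring

theorem outflow_sub_inflow {n : ℕ} (hn : n ≠ 0) (a b : ℕ) :
    inflowRight n (a + 1) b - inflowRight n a b + (inflowUp n a (b + 1) - inflowUp n a b)
      = (if a = 0 ∧ b = 0 then 1 else 0) - 1 / (n : ℝ) ^ 2 := by
  have out := outflow_antidiagonal a b
  have inn := inflow_antidiagonal a b
  have hrow : ((a + 1 : ℕ) : ℝ) / n ^ 2 = a / n ^ 2 + 1 / n ^ 2 := by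
    rw [Nat.cast_succ, add_div]
  simp only [inflowRight, inflowUp, hrow]
  have origin : 1 / (a + b + 1 : ℝ) - (if a = 0 ∧ b = 0 then 0 else 1 / (a + b + 1 : ℝ))
      = if a = 0 ∧ b = 0 then 1 else 0 := by
    split_ifs with h
    · simp [h]
    · exact sub_self _
  rcases lt_trichotomy (a + b + 1) n with h | h | h
  · rw [if_pos (by omega), if_pos (by omega), if_pos (by omega), if_pos (by omega)]
    linear_combination out - inn + origin
  · rw [if_neg (by omega), if_pos (by omega), if_neg (by omega), if_pos (by omega)]
    have hsum : 1 / (n : ℝ) = 1 / (a + b + 1) := by rw [← h]; push_cast; rfl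
    linear_combination hsum - inn + origin
  · rw [if_neg (by omega), if_neg (by omega), if_neg (by omega), if_neg (by omega),
      if_neg (by omega)]
    ring

theorem div_antidiagonal_le (a b : ℕ) :
    (a : ℝ) / ((a + b) * (a + b + 1)) ≤ 1 / (a + b + 1) := by
  rw [← div_div]
  gcongr
  exact div_le_one_of_le₀ (by simp) (by positivity)

theorem inflowUp_sq_le (n a b : ℕ) : inflowUp n a b ^ 2 ≤ 1 / (a + b + 1 : ℝ) ^ 2 := by
  rw [← one_div_pow]
  refine pow_le_pow_left₀ (by unfold inflowUp; positivity) ?_ 2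
  unfold inflowUp
  split_ifs with h
  · simpa only [add_comm (a : ℝ) b] using div_antidiagonal_le b a
  · positivity

theorem inflowRight_sq_le {n a : ℕ} (ha : a < n) (b : ℕ) :
    inflowRight n a b ^ 2 ≤ 1 / (a + b + 1 : ℝ) ^ 2 + 1 / n ^ 2 := by
  have ha' : (a : ℝ) ≤ n := by exact_mod_cast ha.le
  have hrow : (0 : ℝ) ≤ a / n ^ 2 := by positivity
  unfold inflowRight
  split_ifs with h
  · have h' : (a + b + 1 : ℝ) ≤ n := by exact_mod_cast h
    have hle : (a : ℝ) / n ^ 2 ≤ a / ((a + b) * (a + b + 1)) := by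
      rcases a.eq_zero_or_pos with rfl | hpos
      · simp
      have : (0 : ℝ) < a := by exact_mod_cast hpos
      gcongr
      nlinarith
    calc _ ≤ (1 / (a + b + 1) : ℝ) ^ 2 :=
          pow_le_pow_left₀ (sub_nonneg.2 hle) (by linarith [div_antidiagonal_le a b]) 2
      _ ≤ _ := by rw [one_div_pow]; exact le_add_of_nonneg_right (by positivity)
  · have hle : (a : ℝ) / n ^ 2 ≤ 1 / n := by
      rw [sq, ← div_div]
      gcongr
      exact div_le_one_of_le₀ ha' (by positivity)
    calc _ ≤ (1 / n : ℝ) ^ 2 := pow_le_pow_left₀ (sub_nonneg.2 hle) (by linarith) 2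
      _ ≤ _ := by rw [one_div_pow]; exact le_add_of_nonneg_left (by positivity)

theorem sum_range_one_div_add_sq_le (n a : ℕ) :
    ∑ b ∈ Finset.range n, 1 / (a + b + 1 : ℝ) ^ 2 ≤ 2 / (a + 1 : ℝ) := by
  refine le_trans (le_of_eq ?_) (sum_Ioo_inv_sq_le a (a + 1 + n))
  rw [← Finset.Ico_add_one_left_eq_Ioo, Finset.sum_Ico_eq_sum_range, Nat.add_sub_cancel_left]
  exact Finset.sum_congr rfl fun b _ => by push_cast; rw [one_div, add_right_comm]

theorem sum_sum_range_one_div_add_sq_le (n : ℕ) :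
    ∑ a ∈ Finset.range n, ∑ b ∈ Finset.range n, 1 / (a + b + 1 : ℝ) ^ 2
      ≤ 2 * (1 + Real.log n) := by
  have harm : ∑ a ∈ Finset.range n, (a + 1 : ℝ)⁻¹ ≤ 1 + Real.log n := by
    simpa [harmonic] using harmonic_le_one_add_log n
  calc _ ≤ ∑ a ∈ Finset.range n, 2 * (a + 1 : ℝ)⁻¹ :=
        Finset.sum_le_sum fun a _ => sum_range_one_div_add_sq_le n a
    _ ≤ 2 * (1 + Real.log n) := by rw [← Finset.mul_sum]; gcongr

/-- The flow of `inflowRight` and `inflowUp` from the vertex `0` of the torus, as an antisymmetric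
function on the directed edges: its value at `(i, x)` is the flow leaving `x` in direction `i`. -/
def edgeFlow (n : ℕ) : Basis n → ℝ
  | (.right, x) => inflowRight n (x.1 + 1).val x.2.val
  | (.left, x) => -inflowRight n x.1.val x.2.val
  | (.up, x) => inflowUp n x.1.val (x.2 + 1).val
  | (.down, x) => -inflowUp n x.1.val x.2.val

theorem edgeFlow_flip {n : ℕ} (i : Dir) (x : Vertex n) :
    edgeFlow n (i.flip, x + i.step n) = -edgeFlow n (i, x) := by
  cases i <;> simp [Dir.flip, Dir.step, edgeFlow]

section Torus

variable {n : ℕ} [NeZero n]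

theorem sum_zmod_val {M : Type*} [AddCommMonoid M] (f : ℕ → M) :
    ∑ a : ZMod n, f a.val = ∑ a ∈ Finset.range n, f a := by
  obtain ⟨m, rfl⟩ := Nat.exists_eq_succ_of_ne_zero (NeZero.ne n)
  exact Fin.sum_univ_eq_sum_range f (m + 1)

theorem apply_val_add_one {α : Type*} {f : ℕ → α} (hf : f n = f 0) (a : ZMod n) :
    f (a + 1).val = f (a.val + 1) := by
  have hcast : a + 1 = ((a.val + 1 : ℕ) : ZMod n) := by simp
  rcases (Nat.succ_le_of_lt a.val_lt).lt_or_eq with h | h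
  · rw [hcast, ZMod.val_cast_of_lt h]
  · rw [hcast, show a.val + 1 = n from h, ZMod.natCast_self, ZMod.val_zero, hf]

theorem sum_edgeFlow (x : Vertex n) :
    ∑ i, edgeFlow n (i, x) = (if x = 0 then 1 else 0) - 1 / (n : ℝ) ^ 2 := by
  have hx : x = 0 ↔ x.1.val = 0 ∧ x.2.val = 0 := by simp [Prod.ext_iff, ZMod.val_eq_zero]
  simp only [hx, ← outflow_sub_inflow (NeZero.ne n), Dir.sum_univ, edgeFlow,
    apply_val_add_one (f := (inflowRight n · _)) (inflowRight_period x.2.val_lt),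
    apply_val_add_one (inflowUp_period n _)]
  ring

theorem sum_inflowRight_sq_le :
    ∑ x : Vertex n, inflowRight n x.1.val x.2.val ^ 2 ≤ 3 + 2 * Real.log n := by
  have hn : (n : ℝ) ≠ 0 := NeZero.ne _
  calc ∑ x : Vertex n, inflowRight n x.1.val x.2.val ^ 2
      ≤ ∑ x : Vertex n, (1 / (x.1.val + x.2.val + 1 : ℝ) ^ 2 + 1 / n ^ 2) :=
        Finset.sum_le_sum fun x _ => inflowRight_sq_le x.1.val_lt _
    _ = ∑ a ∈ Finset.range n, ∑ b ∈ Finset.range n, 1 / (a + b + 1 : ℝ) ^ 2 + 1 := by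
      rw [Finset.sum_add_distrib, Fintype.sum_prod_type, ← sum_zmod_val]
      simp only [← sum_zmod_val (n := n)]
      simp only [Finset.sum_const, Finset.card_univ, Fintype.card_prod, ZMod.card, nsmul_eq_mul,
        Nat.cast_mul]
      field_simp
    _ ≤ 3 + 2 * Real.log n := by linarith [sum_sum_range_one_div_add_sq_le n]

theorem sum_inflowUp_sq_le :
    ∑ x : Vertex n, inflowUp n x.1.val x.2.val ^ 2 ≤ 2 + 2 * Real.log n := by
  calc ∑ x : Vertex n, inflowUp n x.1.val x.2.val ^ 2
      ≤ ∑ x : Vertex n, 1 / (x.1.val + x.2.val + 1 : ℝ) ^ 2 :=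
        Finset.sum_le_sum fun x _ => inflowUp_sq_le n _ _
    _ = ∑ a ∈ Finset.range n, ∑ b ∈ Finset.range n, 1 / (a + b + 1 : ℝ) ^ 2 := by
      rw [Fintype.sum_prod_type, ← sum_zmod_val]
      simp only [← sum_zmod_val (n := n)]
    _ ≤ 2 + 2 * Real.log n := by linarith [sum_sum_range_one_div_add_sq_le n]

theorem sum_edgeFlow_sq_le : ∑ b, edgeFlow n b ^ 2 ≤ 10 + 8 * Real.log n := by
  have hright : ∑ x : Vertex n, inflowRight n (x.1 + 1).val x.2.val ^ 2
      = ∑ x : Vertex n, inflowRight n x.1.val x.2.val ^ 2 := by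
    simpa using Equiv.sum_comp (Equiv.addRight ((1, 0) : Vertex n)) fun x : Vertex n =>
      inflowRight n x.1.val x.2.val ^ 2
  have hup : ∑ x : Vertex n, inflowUp n x.1.val (x.2 + 1).val ^ 2
      = ∑ x : Vertex n, inflowUp n x.1.val x.2.val ^ 2 := by
    simpa using Equiv.sum_comp (Equiv.addRight ((0, 1) : Vertex n)) fun x : Vertex n =>
      inflowUp n x.1.val x.2.val ^ 2
  rw [Fintype.sum_prod_type, Dir.sum_univ]
  simp only [edgeFlow, neg_sq, hright, hup]
  linarith [sum_inflowRight_sq_le (n := n), sum_inflowUp_sq_le (n := n)]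

end Torus

theorem one_sub_inv_pow_ceil_le {M : ℝ} (hM : 1 ≤ M) (k : ℝ) :
    (1 - M⁻¹) ^ ⌈k * M⌉₊ ≤ Real.exp (-k) := by
  have hM' : 0 < M := one_pos.trans_le hM
  calc (1 - M⁻¹) ^ ⌈k * M⌉₊ ≤ Real.exp (-M⁻¹) ^ ⌈k * M⌉₊ := by
        have := inv_le_one_of_one_le₀ hM
        gcongr
        exact Real.one_sub_le_exp_neg _
    _ = Real.exp (-(⌈k * M⌉₊ / M)) := by rw [← Real.exp_nat_mul, mul_neg, div_eq_mul_inv]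
    _ ≤ Real.exp (-k) := by
      gcongr
      exact (le_div_iff₀ hM').2 (Nat.le_ceil _)

theorem exp_neg_seven_lt : Real.exp (-7) < 1 / 512 := by
  rw [Real.exp_neg, ← one_div, show (7 : ℝ) = (7 : ℕ) * 1 by norm_num, Real.exp_nat_mul]
  gcongr
  calc (512 : ℝ) < 2.7 ^ 7 := by norm_num
    _ < Real.exp 1 ^ 7 := by gcongr; linarith [Real.exp_one_gt_d9]

theorem one_le_log_sq {n : ℕ} (hn : 2 ≤ n) : 1 ≤ Real.log ((n : ℝ) ^ 2) := by
  have hn' : (2 : ℝ) ≤ n := by exact_mod_cast hn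
  rw [Real.le_log_iff_exp_le (by positivity)]
  nlinarith [Real.exp_one_lt_d9]

/-- The time scale `√(N log N)` of the search on a grid with `N = n ^ 2` vertices. -/
def searchTime (n : ℕ) : ℝ := √((n : ℝ) ^ 2 * Real.log ((n : ℝ) ^ 2))

theorem searchTime_eq (n : ℕ) : searchTime n = n * √(Real.log ((n : ℝ) ^ 2)) := by
  rw [searchTime, Real.sqrt_mul (by positivity), Real.sqrt_sq (by positivity)]

theorem one_lt_searchTime {n : ℕ} (hn : 2 ≤ n) : 1 < searchTime n := by
  have hn' : (2 : ℝ) ≤ n := by exact_mod_cast hn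
  rw [searchTime_eq]
  nlinarith [Real.one_le_sqrt.2 (one_le_log_sq hn)]

section Search

variable {n : ℕ} [NeZero n]

theorem norm_sub_walkUnitary_le {v : Vertex n} {p : EuclideanSpace ℂ (Basis n)}
    (hflip : ∀ i x, p (i.flip, x + i.step n) = -p (i, x))
    (hdiv : ∀ x, ∑ i, p (i, x) = (if x = v then 1 else 0) - 1 / (n : ℂ) ^ 2) :
    ‖p - walkUnitary v p‖ ≤ 1 / n := by
  have entry (b : Basis n) : ‖(p - walkUnitary v p) b‖ ^ 2 ≤ (1 / (2 * n ^ 2) : ℝ) ^ 2 := by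
    obtain ⟨i, x⟩ := b
    rw [PiLp.sub_apply, walkUnitary_apply, hflip, hdiv]
    split_ifs
    · simp
    · refine le_of_eq (congrArg (· ^ 2) ?_)
      rw [show p (i, x) - (1 / 2 * (0 - 1 / (n : ℂ) ^ 2) - -p (i, x)) = 1 / (2 * n ^ 2) by ring]
      simp
  have hn : (n : ℝ) ≠ 0 := NeZero.ne _
  rw [EuclideanSpace.norm_eq, Real.sqrt_le_left (by positivity)]
  calc ∑ b, ‖(p - walkUnitary v p) b‖ ^ 2 ≤ ∑ _b : Basis n, (1 / (2 * n ^ 2) : ℝ) ^ 2 :=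
        Finset.sum_le_sum fun b _ => entry b
    _ = (1 / n) ^ 2 := by
      rw [Finset.sum_const, Finset.card_univ, nsmul_eq_mul, card_basis]
      field_simp
      norm_num

/-- The flow `edgeFlow` as a vector of the Hilbert space of the walk. -/
def flowState (n : ℕ) : EuclideanSpace ℂ (Basis n) := WithLp.toLp 2 fun b => (edgeFlow n b : ℂ)

theorem sum_flowState (x : Vertex n) :
    ∑ i, flowState n (i, x) = (if x = 0 then 1 else 0) - 1 / (n : ℂ) ^ 2 := by
  have h := congrArg (fun r : ℝ => (r : ℂ)) (sum_edgeFlow x)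
  push_cast [apply_ite (fun r : ℝ => (r : ℂ))] at h
  exact h

theorem norm_sub_walkUnitary_flowState_le :
    ‖flowState n - walkUnitary 0 (flowState n)‖ ≤ 1 / n :=
  norm_sub_walkUnitary_le (fun i x => by simp [flowState, edgeFlow_flip]) sum_flowState

theorem le_norm_inner_markedState_flowState (hn : 2 ≤ n) :
    3 / 8 ≤ ‖⟪markedState 0, flowState n⟫_ℂ‖ := by
  have hn' : (2 : ℝ) ≤ n := by exact_mod_cast hn
  have hsmall : 1 / (n : ℝ) ^ 2 ≤ 1 / 2 ^ 2 := by gcongr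
  rw [inner_markedState, sum_flowState, if_pos rfl]
  refine le_trans ?_ (Complex.re_le_norm _)
  have hreal : 1 / 2 * (1 - 1 / (n : ℂ) ^ 2) = (1 / 2 * (1 - 1 / n ^ 2) : ℝ) := by push_cast; rfl
  rw [hreal, Complex.ofReal_re]
  linarith

theorem norm_flowState_le (hn : 2 ≤ n) : ‖flowState n‖ ≤ 4 * √(Real.log ((n : ℝ) ^ 2)) := by
  have hlog := one_le_log_sq hn
  rw [EuclideanSpace.norm_eq, Real.sqrt_le_left (by positivity), mul_pow,
    Real.sq_sqrt (by linarith)]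
  have henergy := sum_edgeFlow_sq_le (n := n)
  have hsq : Real.log ((n : ℝ) ^ 2) = 2 * Real.log n := by simp
  simp only [flowState, Complex.norm_real, Real.norm_eq_abs, sq_abs]
  linarith

theorem le_norm_abelSum (hn : 2 ≤ n) :
    n / 16 ≤ ‖abelSum (walkUnitary (0 : Vertex n)) (markedState 0) (1 - (searchTime n)⁻¹)‖ := by
  have hM := one_lt_searchTime hn
  have hz : |1 - (searchTime n)⁻¹| < 1 := by
    have hinv := inv_lt_one_of_one_lt₀ hM
    have hinv' := inv_pos.2 (one_pos.trans hM)
    exact abs_lt.2 ⟨by linarith, by linarith⟩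
  have hn' : (0 : ℝ) < n := Nat.cast_pos'.2 (by omega)
  have hsqrt : 0 < √(Real.log ((n : ℝ) ^ 2)) :=
    Real.sqrt_pos.2 (one_pos.trans_le (one_le_log_sq hn))
  have hdefect : (1 - (1 - (searchTime n)⁻¹)) * ‖flowState n‖
      + ‖flowState n - walkUnitary 0 (flowState n)‖ ≤ 5 / n := by
    calc _ ≤ (searchTime n)⁻¹ * (4 * √(Real.log ((n : ℝ) ^ 2))) + 1 / n := by
          rw [sub_sub_cancel]
          gcongr
          · exact norm_flowState_le hn
          · exact norm_sub_walkUnitary_flowState_le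
      _ = 5 / n := by
        rw [searchTime_eq]
        field_simp
        norm_num
  set A := ‖abelSum (walkUnitary (0 : Vertex n)) (markedState 0) (1 - (searchTime n)⁻¹)‖
  have hA : 3 / 8 ≤ A * (5 / n) :=
    calc 3 / 8 ≤ _ := le_norm_inner_markedState_flowState hn
      _ ≤ _ := norm_inner_le_norm_abelSum_mul (walkUnitary 0) (markedState 0) hz (flowState n)
      _ ≤ A * (5 / n) := by gcongr
  rw [mul_div_assoc', le_div_iff₀ hn'] at hA
  linarith

theorem exists_le_norm_inner_stateAfter (hn : 2 ≤ n) :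
    ∃ T : ℕ, T ≤ 7 * searchTime n ∧ 1 / (512 * √(Real.log ((n : ℝ) ^ 2)))
      ≤ ‖⟪markedState 0, WithLp.toLp 2 (stateAfter n 0 T)⟫_ℂ‖ := by
  have hM := one_lt_searchTime hn
  have hsqrt : 0 < √(Real.log ((n : ℝ) ^ 2)) :=
    Real.sqrt_pos.2 (one_pos.trans_le (one_le_log_sq hn))
  have hover : ‖⟪markedState 0, WithLp.toLp 2 (uniformState n)⟫_ℂ‖ = 1 / n := by
    simp [inner_markedState_uniformState]
  have htail : (1 - (searchTime n)⁻¹) ^ ⌈7 * searchTime n⌉₊ < 1 / 512 :=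
    (one_sub_inv_pow_ceil_le hM.le 7).trans_lt exp_neg_seven_lt
  have hlow : 1 / n * (n / 16 : ℝ) ^ 2 ≤ 1 / n *
      ‖abelSum (walkUnitary (0 : Vertex n)) (markedState 0) (1 - (searchTime n)⁻¹)‖ ^ 2 := by
    have := le_norm_abelSum hn
    gcongr
  have hlarge : 1 / (512 * √(Real.log ((n : ℝ) ^ 2))) / (1 - (1 - (searchTime n)⁻¹))
      + (1 - (searchTime n)⁻¹) ^ ⌈7 * searchTime n⌉₊ / (1 / n) < 1 / n *
      ‖abelSum (walkUnitary (0 : Vertex n)) (markedState 0) (1 - (searchTime n)⁻¹)‖ ^ 2 :=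
    calc _ = n / 512 + (1 - (searchTime n)⁻¹) ^ ⌈7 * searchTime n⌉₊ * n := by
          rw [div_div_eq_mul_div _ 1, div_one, sub_sub_cancel, div_inv_eq_mul, searchTime_eq]
          field_simp
      _ < n / 512 + 1 / 512 * n := by gcongr
      _ = 1 / n * (n / 16) ^ 2 := by field_simp; norm_num
      _ ≤ _ := hlow
  rw [← hover] at hlarge
  obtain ⟨T, hT, hle⟩ := exists_le_norm_inner_pow
    (sub_nonneg.2 (inv_le_one_of_one_le₀ hM.le)) (sub_lt_self 1 (inv_pos.2 (one_pos.trans hM)))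
    (norm_markedState 0) norm_uniformState (walkUnitary_reflect_uniformState 0)
    (norm_pos_iff.1 (by rw [hover]; positivity)) (by positivity) hlarge
  refine ⟨T, (Nat.lt_ceil.1 hT).le, ?_⟩
  rwa [← walkUnitary_pow_uniformState]

theorem exists_le_successProb (hn : 2 ≤ n) :
    ∃ T : ℕ, T ≤ 7 * searchTime n ∧
      ∀ v : Vertex n, 1 / 2 ^ 18 / Real.log ((n : ℝ) ^ 2) ≤ successProb n v T := by
  obtain ⟨T, hT, hle⟩ := exists_le_norm_inner_stateAfter hn
  refine ⟨T, hT, fun v => ?_⟩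
  rw [successProb_eq_successProb_zero]
  calc 1 / 2 ^ 18 / Real.log ((n : ℝ) ^ 2) = (1 / (512 * √(Real.log ((n : ℝ) ^ 2)))) ^ 2 := by
        rw [div_pow, mul_pow, Real.sq_sqrt (by linarith [one_le_log_sq hn]), div_div]
        norm_num
    _ ≤ ‖⟪markedState 0, WithLp.toLp 2 (stateAfter n 0 T)⟫_ℂ‖ ^ 2 := by gcongr
    _ ≤ successProb n 0 T := norm_inner_markedState_sq_le_successProb 0 T

end Search

end GridWalk

end

theorem theorem1 :
    ∃ (T : ℕ → ℕ) (K c : ℝ), 0 < K ∧ 0 < c ∧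
      ∀ (n : ℕ) [NeZero n], 2 ≤ n →
        (T n : ℝ) ≤ K * √((n : ℝ) ^ 2 * Real.log ((n : ℝ) ^ 2)) ∧
        ∀ v : GridWalk.Vertex n,
          c / Real.log ((n : ℝ) ^ 2) ≤ GridWalk.successProb n v (T n) := by
  have exists_time (n : ℕ) : ∃ T : ℕ, ∀ [NeZero n], 2 ≤ n → T ≤ 7 * GridWalk.searchTime n ∧
      ∀ v, 1 / 2 ^ 18 / Real.log ((n : ℝ) ^ 2) ≤ GridWalk.successProb n v T := by
    rcases lt_or_ge n 2 with hn | hn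
    · exact ⟨0, fun hn' => absurd hn' hn.not_ge⟩
    · have : NeZero n := ⟨by omega⟩
      obtain ⟨T, hT⟩ := GridWalk.exists_le_successProb hn
      exact ⟨T, fun _ => hT⟩
  choose T hT using exists_time
  exact ⟨T, 7, 1 / 2 ^ 18, by norm_num, by norm_num, fun n _ hn => hT n hn⟩
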